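/- For $g\in L^2(\mathbb R)$ (complex-valued) let $E_mT_ng(x)=e^{2\pi i mx}g(x-n)$, $m,n\in\mathbb Z$, and $G_k(t)=\sum_{n\in\mathbb Z}g(t-n)\overline{g(t-n-k)}$, $k\in\mathbb Z$. One says that $(g,1,1)$ is a WH-frame if there are constants $A,B>0$ with $$A\|f\|^2\le\sum_{m,n\in\mathbb Z}|\langle f,E_mT_ng\rangle|^2\le B\|f\|^2\qquad\text{for all } f\in L^2(\mathbb R).$$ The WH-frame identity for $f$ is $$\sum_{m,n\in\mathbb Z}|\langle f,E_mT_ng\rangle|^2=\sum_{k\in\mathbb Z}\int_{\mathbb R}\overline{f(t)}\,f(t-k)\,G_k(t)\,dt .$$ **Corollary.** There exist a WH-frame $(g,1,1)$ and a function $f\in L^2(\mathbb R)$ for which the WH-frame identity fails in the sense that the series on its right side does not converge symmetrically: for a.e. $t$ all the series $G_k(t)$ converge absolutely, and each integrand $\overline{f(t)}f(t-k)G_k(t)$ is integrable, but the limit $$\lim_{K\to\infty}\ \sum_{k=-K}^{K}\int_{\mathbb R}\overline{f(t)}\,f(t-k)\,G_k(t)\,dt$$ does not exist in $\mathbb C$.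 -/

import Mathlib

open MeasureTheory Filter Topology
open scoped ComplexConjugate ENNReal

noncomputable section

/-- The complex Hilbert space `L²(ℝ)`, with respect to Lebesgue measure. -/
abbrev L2R : Type := Lp ℂ 2 (volume : Measure ℝ)

/-- Frames of a complex Hilbert space, with (unconditionally) convergent sums of squares.
Mathlib's inner product is linear in the second variable, so the scalar product `⟨f, fᵢ⟩` that is
linear in `f` is `inner ℂ (fᵢ) f`. -/
def IsHilbertFrame {ι H : Type*} [NormedAddCommGroup H] [InnerProductSpace ℂ H] (e : ι → H) : Prop :=
  ∃ A B : ℝ, 0 < A ∧ 0 < B ∧ ∀ f : H,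
    Summable (fun i => ‖inner ℂ (e i) f‖ ^ 2) ∧
    A * ‖f‖ ^ 2 ≤ ∑' i, ‖inner ℂ (e i) f‖ ^ 2 ∧
    ∑' i, ‖inner ℂ (e i) f‖ ^ 2 ≤ B * ‖f‖ ^ 2

/-- Translation: `T_a f (x) = f (x - a)`. -/
def whTranslate (a : ℝ) (f : ℝ → ℂ) : ℝ → ℂ := fun x => f (x - a)

/-- Modulation: `E_a f (x) = e^{2πiax} f (x)`. -/
def whModulate (a : ℝ) (f : ℝ → ℂ) : ℝ → ℂ :=
  fun x => Complex.exp (2 * Real.pi * Complex.I * a * x) * f x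

theorem memLp_whTranslate (a : ℝ) {f : ℝ → ℂ} (hf : MemLp f 2 volume) :
    MemLp (whTranslate a f) 2 volume :=
  hf.comp_measurePreserving (measurePreserving_sub_right volume a)

theorem memLp_whModulate (a : ℝ) {f : ℝ → ℂ} (hf : MemLp f 2 volume) :
    MemLp (whModulate a f) 2 volume := by
  have hc : Continuous fun x : ℝ => Complex.exp (2 * Real.pi * Complex.I * a * x) := by
    fun_prop
  refine hf.of_le (hc.aestronglyMeasurable.mul hf.1) (Eventually.of_forall fun x => ?_)
  have h : ‖Complex.exp (2 * Real.pi * Complex.I * a * x)‖ = 1 := by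
    rw [Complex.norm_exp]
    simp
  simp only [whModulate, norm_mul, h, one_mul, le_refl]

/-- The Weyl-Heisenberg system `(g, a, b)`, i.e. the family `E_{mb} T_{na} g`, indexed by
`(m, n) ∈ ℤ × ℤ`. -/
def whSystem (g : L2R) (a b : ℝ) (p : ℤ × ℤ) : L2R :=
  MemLp.toLp (whModulate (p.1 * b) (whTranslate (p.2 * a) g))
    (memLp_whModulate _ (memLp_whTranslate _ (Lp.memLp g)))

/-- `(g, a, b)` is a WH-frame: the Weyl-Heisenberg system is a frame for `L²(ℝ)`. -/
def IsWHFrame (g : L2R) (a b : ℝ) : Prop := IsHilbertFrame (whSystem g a b)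

/-- The `n`-th term of the series defining `G_k(t)`. -/
def whCorrTerm (g : L2R) (a b : ℝ) (k : ℤ) (t : ℝ) (n : ℤ) : ℂ :=
  g (t - n * a) * conj (g (t - n * a - k / b))

/-- `G_k(t) = ∑ₙ g(t - na) conj(g(t - na - k/b))`. -/
def whCorr (g : L2R) (a b : ℝ) (k : ℤ) (t : ℝ) : ℂ :=
  ∑' n : ℤ, whCorrTerm g a b k t n

/-- The integrand `conj(f(t)) f(t - k/b) G_k(t)` on the right side of the WH-frame identity. -/
def whIntegrand (g : L2R) (a b : ℝ) (f : L2R) (k : ℤ) (t : ℝ) : ℂ :=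
  conj (f t) * f (t - k / b) * whCorr g a b k t

/-- The symmetric partial sums
`(1/b) ∑_{k=-K}^{K} ∫ conj(f(t)) f(t - k/b) G_k(t) dt` of the right side of the
WH-frame identity. -/
def whSymmPartialSum (g : L2R) (a b : ℝ) (f : L2R) (K : ℕ) : ℂ :=
  (1 / b : ℂ) * ∑ k ∈ Finset.Icc (-(K : ℤ)) (K : ℤ), ∫ t : ℝ, whIntegrand g a b f k t

/-- The right side of the WH-frame identity for `f` converges symmetrically. -/
def WHConvergesSymmetrically (g : L2R) (a b : ℝ) (f : L2R) : Prop :=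
  ∃ l : ℂ, Tendsto (whSymmPartialSum g a b f) atTop (𝓝 l)

end

/-! Take `g` and `f` constant on the intervals `[n, n+1)`, with values the Fourier coefficients of
functions `h`, `η` in `L²(𝕋)`. By Parseval, `G_k` is a.e. the constant `k`-th coefficient of `|h|²`,
and the `k`-th integral is that constant times the `(-k)`-th coefficient of `|η|²`
(`integral_whIntegrand_stepL2`). The right side is thus the formal Parseval series of `|h|²` against
`|η|²`, while the frame condition only asks that `|h|²` lie between positive constants
(`isWHFrame_stepL2`).

It remains to find a continuous `φ = |h|² ≥ 1` and `|η|²` in `L¹` whose Parseval series diverges.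
Otherwise Banach–Steinhaus, used in both variables, bounds the symmetric partial sums uniformly as
bilinear forms on `L¹ × C(𝕋)`. Letting the `L¹` function concentrate at `0` would then bound the
partial Fourier sums at `0` of all continuous functions by their sup norms, which
`modulatedSawtooth` contradicts. -/

/-! ### Divergence of a Parseval series on the circle -/

section CircleDivergence

open AddCircle

set_option maxSynthPendingDepth 3

/-- The Fourier coefficient as a continuous linear functional on the real space `L¹(𝕋)`. -/
noncomputable def fourierCoeffL1 (k : ℤ) :
    Lp ℝ 1 (haarAddCircle (T := (1 : ℝ))) →L[ℝ] ℂ :=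
  LinearMap.mkContinuous
    { toFun := fun ψ => fourierCoeff (fun x => (ψ x : ℂ)) k
      map_add' := fun ψ χ => by
        rw [← Pi.add_apply (fourierCoeff _) (fourierCoeff _) k, ← fourierCoeff.add
          (L1.integrable_coeFn ψ).ofReal (L1.integrable_coeFn χ).ofReal]
        refine congrFun (fourierCoeff_congr_ae ?_) k
        filter_upwards [Lp.coeFn_add ψ χ] with x hx
        rw [hx]
        simp
      map_smul' := fun c ψ => by
        rw [RingHom.id_apply, Complex.real_smul, ← fourierCoeff.const_mul]
        refine congrFun (fourierCoeff_congr_ae ?_) k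
        filter_upwards [Lp.coeFn_smul c ψ] with x hx
        rw [hx]
        simp } 1 (fun ψ => by
    rw [one_mul, L1.norm_eq_integral_norm]
    refine (norm_integral_le_integral_norm _).trans (le_of_eq ?_)
    congr 1 with x
    rw [norm_smul, Complex.norm_real, fourier_apply, Circle.norm_coe, one_mul])

theorem fourierCoeffL1_apply (k : ℤ) (ψ : Lp ℝ 1 (haarAddCircle (T := (1 : ℝ)))) :
    fourierCoeffL1 k ψ = fourierCoeff (fun x => (ψ x : ℂ)) k := rfl

theorem fourierCoeffL1_toLp (k : ℤ) (φ : C(AddCircle (1 : ℝ), ℝ)) :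
    fourierCoeffL1 k (ContinuousMap.toLp 1 haarAddCircle ℝ φ) =
      fourierCoeff (fun x => (φ x : ℂ)) k := by
  rw [fourierCoeffL1_apply]
  refine congrFun (fourierCoeff_congr_ae ?_) k
  filter_upwards [ContinuousMap.coeFn_toLp (p := 1) haarAddCircle (𝕜 := ℝ) φ] with x hx
  rw [hx]

/-- The symmetric partial sums of `∑ₖ φ̂(k) ψ̂(-k)`, as bounded bilinear maps. -/
noncomputable def pairingPartialSum (K : ℕ) :
    Lp ℝ 1 (haarAddCircle (T := (1 : ℝ))) →L[ℝ] C(AddCircle (1 : ℝ), ℝ) →L[ℝ] ℂ :=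
  ∑ k ∈ Finset.Icc (-(K : ℤ)) (K : ℤ),
    (ContinuousLinearMap.mul ℝ ℂ).flip.bilinearComp (fourierCoeffL1 (-k))
      ((fourierCoeffL1 k).comp (ContinuousMap.toLp 1 haarAddCircle ℝ))

theorem pairingPartialSum_apply (K : ℕ) (ψ : Lp ℝ 1 (haarAddCircle (T := (1 : ℝ))))
    (φ : C(AddCircle (1 : ℝ), ℝ)) :
    pairingPartialSum K ψ φ = ∑ k ∈ Finset.Icc (-(K : ℤ)) (K : ℤ),
      fourierCoeff (fun x => (φ x : ℂ)) k * fourierCoeff (fun x => (ψ x : ℂ)) (-k) := by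
  simp only [pairingPartialSum, _root_.sum_apply,
    ContinuousLinearMap.bilinearComp_apply, ContinuousLinearMap.flip_apply,
    ContinuousLinearMap.mul_apply', ContinuousLinearMap.comp_apply, fourierCoeffL1_toLp]
  rfl

/-- The continuous function `(x - 1/2) sin (2πMx)` on the circle. -/
noncomputable def modulatedSawtooth (M : ℕ) : C(AddCircle (1 : ℝ), ℝ) where
  toFun := AddCircle.liftIco 1 0 fun x => (x - 1 / 2) * Real.sin (2 * Real.pi * M * x)
  continuous_toFun := by
    refine AddCircle.liftIco_zero_continuous ?_ (by fun_prop)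
    -- The sine vanishes at both endpoints and so removes the jump of the sawtooth.
    have : Real.sin (2 * Real.pi * M * 1) = 0 := by
      rw [show 2 * Real.pi * M * 1 = ((2 * M : ℕ) : ℝ) * Real.pi by push_cast; ring]
      exact Real.sin_nat_mul_pi _
    rw [this]
    simp

theorem modulatedSawtooth_coe (M : ℕ) {y : ℝ} (hy : y ∈ Set.Ico (0 : ℝ) 1) :
    modulatedSawtooth M (y : AddCircle (1 : ℝ)) =
      (y - 1 / 2) * Real.sin (2 * Real.pi * M * y) := by
  have hy' : y ∈ Set.Ico (0 : ℝ) (0 + 1) := by rwa [zero_add]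
  exact AddCircle.liftIco_coe_apply (f := fun x => (x - 1 / 2) * Real.sin (2 * Real.pi * M * x)) hy'

theorem norm_modulatedSawtooth_le (M : ℕ) : ‖modulatedSawtooth M‖ ≤ 1 := by
  refine (ContinuousMap.norm_le _ zero_le_one).2 fun x => ?_
  obtain ⟨y, hy, rfl⟩ := AddCircle.eq_coe_Ico x
  rw [modulatedSawtooth_coe M hy, norm_mul]
  have h1 : ‖y - 1 / 2‖ ≤ 1 := by
    rw [Real.norm_eq_abs, abs_le]; constructor <;> linarith [hy.1, hy.2]
  have h2 : ‖Real.sin (2 * Real.pi * M * y)‖ ≤ 1 := Real.abs_sin_le_one _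
  exact mul_le_one₀ h1 (norm_nonneg _) h2

/-- Writing the sine as two exponentials shifts the coefficients of the sawtooth `x - 1/2` by `±M`.
-/
theorem fourierCoeff_modulatedSawtooth (M : ℕ) (k : ℤ) :
    fourierCoeff (fun x => (modulatedSawtooth M x : ℂ)) k =
      (bernoulliFourierCoeff 1 (k - M) - bernoulliFourierCoeff 1 (k + M)) / (2 * Complex.I) := by
  have h : (fun x => (modulatedSawtooth M x : ℂ)) = AddCircle.liftIco 1 0
      (fun x : ℝ => (((x - 1 / 2) * Real.sin (2 * Real.pi * M * x) : ℝ) : ℂ)) := by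
    ext x
    obtain ⟨y, hy, rfl⟩ := AddCircle.eq_coe_Ico x
    rw [AddCircle.liftIco_coe_apply (by rwa [zero_add])]
    rw [modulatedSawtooth_coe M hy]
  rw [h, fourierCoeff_liftIco_eq]
  simp only [bernoulliFourierCoeff, fourierCoeffOn_eq_integral, zero_add, sub_zero, div_one,
    one_smul]
  rw [← intervalIntegral.integral_sub, ← intervalIntegral.integral_div]
  · refine intervalIntegral.integral_congr fun x _ => ?_
    simp only [fourier_coe_apply, smul_eq_mul, bernoulliFun_one]
    push_cast
    rw [Complex.sin]
    have e1 : Complex.exp (2 * Real.pi * Complex.I * (-((k : ℂ) - M)) * x / 1) =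
        Complex.exp (2 * Real.pi * Complex.I * (-(k : ℂ)) * x / 1) *
          Complex.exp ((2 * Real.pi * M * x) * Complex.I) := by
      rw [← Complex.exp_add]; ring_nf
    have e2 : Complex.exp (2 * Real.pi * Complex.I * (-((k : ℂ) + M)) * x / 1) =
        Complex.exp (2 * Real.pi * Complex.I * (-(k : ℂ)) * x / 1) *
          Complex.exp (-(2 * Real.pi * M * x) * Complex.I) := by
      rw [← Complex.exp_add]; ring_nf
    rw [sub_zero, e1, e2]
    field_simp
    ring_nf
    simp only [Complex.I_sq]
    ring
  all_goals
    refine Continuous.intervalIntegrable ?_ _ _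
    simp only [fourier_coe_apply, bernoulliFun_one]
    fun_prop

/-- For `|k| ≤ M` one shift sees only indices `≤ 0`, the other only indices `≥ 0`. The odd
coefficients `i/(2πn)` therefore add up instead of cancelling and leave a harmonic sum. -/
theorem sum_fourierCoeff_modulatedSawtooth (M : ℕ) :
    ∑ k ∈ Finset.Icc (-(M : ℤ)) (M : ℤ),
      fourierCoeff (fun x => (modulatedSawtooth M x : ℂ)) k =
    -((1 / (2 * Real.pi)) * ∑ j ∈ Finset.range (2 * M), 1 / ((j : ℝ) + 1) : ℝ) := by
  -- At `n = 0` the convention `1 / 0 = 0` agrees with the mean of the sawtooth.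
  have hb : ∀ n : ℤ, bernoulliFourierCoeff 1 n = Complex.I / (2 * Real.pi) * (1 / (n : ℂ)) := by
    intro n
    rw [bernoulliFourierCoeff_eq one_ne_zero]
    rcases eq_or_ne n 0 with rfl | hn
    · simp
    · have : (n : ℂ) ≠ 0 := by exact_mod_cast hn
      have := Complex.I_ne_zero
      have : (Real.pi : ℂ) ≠ 0 := by exact_mod_cast Real.pi_ne_zero
      simp only [Nat.factorial_one, pow_one, Nat.cast_one]
      field_simp
      rw [Complex.I_sq]
  have hneg : ∑ k ∈ Finset.Icc (-(M : ℤ)) (M : ℤ), (1 / ((k - M : ℤ) : ℂ)) =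
      -∑ k ∈ Finset.Icc (-(M : ℤ)) (M : ℤ), (1 / ((k + M : ℤ) : ℂ)) := by
    rw [← Finset.sum_neg_distrib]
    refine Finset.sum_nbij' (fun k => -k) (fun k => -k) ?_ ?_ (by simp) (by simp) ?_
    · intro a ha; simp only [Finset.mem_Icc] at *; omega
    · intro a ha; simp only [Finset.mem_Icc] at *; omega
    · intro k _
      rw [show (k - M : ℤ) = -(-k + M) by ring, Int.cast_neg, div_neg]
  have hpos : ∑ k ∈ Finset.Icc (-(M : ℤ)) (M : ℤ), (1 / ((k + M : ℤ) : ℂ)) =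
      ∑ j ∈ Finset.range (2 * M), 1 / ((j : ℂ) + 1) := by
    have : ∑ k ∈ Finset.Icc (-(M : ℤ)) (M : ℤ), (1 / ((k + M : ℤ) : ℂ)) =
        ∑ j ∈ Finset.range (2 * M + 1), 1 / (j : ℂ) := by
      symm
      refine Finset.sum_nbij' (fun j => (j : ℤ) - M) (fun k => (k + M).toNat) ?_ ?_ ?_ ?_ ?_
      · intro a ha; simp only [Finset.mem_Icc, Finset.mem_range] at *; omega
      · intro a ha; simp only [Finset.mem_Icc, Finset.mem_range] at *; omega
      · intro a ha; simp
      · intro a ha; simp only [Finset.mem_Icc] at *; omega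
      · intro a ha; simp
    rw [this, Finset.sum_range_succ']
    simp
  simp only [fourierCoeff_modulatedSawtooth, hb]
  rw [← Finset.sum_div, Finset.sum_sub_distrib, ← Finset.mul_sum, ← Finset.mul_sum, hneg, hpos]
  have := Complex.I_ne_zero
  have : (Real.pi : ℂ) ≠ 0 := by exact_mod_cast Real.pi_ne_zero
  push_cast
  field_simp
  ring

theorem fourierCoeff_indicatorConstLp {s : Set (AddCircle (1 : ℝ))} (hs : MeasurableSet s)
    (k : ℤ) :
    fourierCoeff (fun x => ((indicatorConstLp 1 hs
      (measure_ne_top haarAddCircle s) (1 : ℝ) : Lp ℝ 1 haarAddCircle) x : ℂ)) (-k) =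
      ∫ x in s, fourier k x ∂haarAddCircle := by
  rw [fourierCoeff, ← integral_indicator hs, neg_neg]
  refine integral_congr_ae ?_
  filter_upwards [indicatorConstLp_coeFn (p := 1) (hs := hs)
    (hμs := measure_ne_top haarAddCircle s) (c := (1 : ℝ))] with x hx
  rw [hx]
  by_cases h : x ∈ s <;> simp [h]

/-- The norm of the pairing with continuous `φ` controls the partial Fourier sums of `φ` at `0`. -/
theorem norm_sum_fourierCoeff_le {C : ℝ} {K : ℕ} (hC : ‖pairingPartialSum K‖ ≤ C)
    (φ : C(AddCircle (1 : ℝ), ℝ)) :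
    ‖∑ k ∈ Finset.Icc (-(K : ℤ)) (K : ℤ), fourierCoeff (fun x => (φ x : ℂ)) k‖ ≤ C * ‖φ‖ := by
  set S : AddCircle (1 : ℝ) → ℂ := fun x => ∑ k ∈ Finset.Icc (-(K : ℤ)) (K : ℤ),
    fourierCoeff (fun x => (φ x : ℂ)) k * fourier k x with hS
  have hScont : Continuous S := by fun_prop
  have hS0 : S 0 = ∑ k ∈ Finset.Icc (-(K : ℤ)) (K : ℤ), fourierCoeff (fun x => (φ x : ℂ)) k := by
    simp only [hS, fourier_eval_zero, mul_one]
  rw [← hS0]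
  refine le_of_forall_pos_le_add fun ε hε => ?_
  obtain ⟨δ, hδ, hball⟩ := Metric.continuousAt_iff.1 (hScont.continuousAt (x := 0)) ε hε
  set B : Set (AddCircle (1 : ℝ)) := Metric.ball 0 δ
  have hB : MeasurableSet B := measurableSet_ball
  have hBpos : 0 < haarAddCircle.real B :=
    ENNReal.toReal_pos (Metric.isOpen_ball.measure_pos _ ⟨0, Metric.mem_ball_self hδ⟩).ne'
      (measure_ne_top _ _)
  -- An unnormalized approximate point mass at `0`: its norm, the measure of `B`, is divided out at
  -- the end.
  set ψ : Lp ℝ 1 (haarAddCircle (T := (1 : ℝ))) :=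
    indicatorConstLp 1 hB (measure_ne_top haarAddCircle B) (1 : ℝ) with hψ
  have hψnorm : ‖ψ‖ = haarAddCircle.real B := by
    rw [hψ, norm_indicatorConstLp one_ne_zero ENNReal.one_ne_top]
    simp
  have hSint : Integrable S haarAddCircle := hScont.integrable_of_hasCompactSupport
    (HasCompactSupport.of_compactSpace _)
  have hpair : pairingPartialSum K ψ φ = ∫ x in B, S x ∂haarAddCircle := by
    rw [pairingPartialSum_apply, hS, integral_finsetSum]
    · refine Finset.sum_congr rfl fun k _ => ?_
      rw [fourierCoeff_indicatorConstLp, integral_const_mul]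
    · intro k _
      exact (((fourier k).continuous.integrable_of_hasCompactSupport
        (HasCompactSupport.of_compactSpace _)).const_mul _).integrableOn
  have h1 : ‖∫ x in B, S x ∂haarAddCircle‖ ≤ C * haarAddCircle.real B * ‖φ‖ := by
    rw [← hpair, ← hψnorm]
    exact ((pairingPartialSum K).le_opNorm₂ ψ φ).trans (by gcongr)
  have h2 : ‖∫ x in B, (S x - S 0) ∂haarAddCircle‖ ≤ ε * haarAddCircle.real B := by
    refine norm_setIntegral_le_of_norm_le_const (measure_lt_top _ _) fun x hx => ?_
    rw [← dist_eq_norm]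
    exact (hball hx).le
  rw [integral_sub hSint.integrableOn (integrable_const _), setIntegral_const] at h2
  have h3 : ‖haarAddCircle.real B • S 0‖ = haarAddCircle.real B * ‖S 0‖ := by
    rw [norm_smul, Real.norm_of_nonneg hBpos.le]
  have h4 := norm_sub_norm_le (haarAddCircle.real B • S 0) (∫ x in B, S x ∂haarAddCircle)
  rw [norm_sub_rev, h3] at h4
  refine le_of_mul_le_mul_left ?_ hBpos
  linarith

theorem not_bounded_pairingPartialSum : ¬ ∃ C, ∀ K, ‖pairingPartialSum K‖ ≤ C := by
  rintro ⟨C, hC⟩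
  have hbound : ∀ M : ℕ, ∑ j ∈ Finset.range (2 * M), 1 / ((j : ℝ) + 1) ≤ 2 * Real.pi * C := by
    intro M
    have h := norm_sum_fourierCoeff_le (hC M) (modulatedSawtooth M)
    have hnn : 0 ≤ ∑ j ∈ Finset.range (2 * M), 1 / ((j : ℝ) + 1) :=
      Finset.sum_nonneg fun j _ => by positivity
    rw [sum_fourierCoeff_modulatedSawtooth, norm_neg, Complex.norm_real, Real.norm_of_nonneg
      (mul_nonneg (by positivity) hnn)] at h
    have hC0 : 0 ≤ C := (norm_nonneg _).trans (hC 0)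
    have h' := h.trans (mul_le_of_le_one_right hC0 (norm_modulatedSawtooth_le M))
    rw [one_div, inv_mul_le_iff₀ (by positivity)] at h'
    exact h'
  have ht := Real.tendsto_sum_range_one_div_nat_succ_atTop.comp
    (tendsto_id.const_mul_atTop' (r := 2) two_pos : Tendsto (fun M : ℕ => 2 * M) atTop atTop)
  obtain ⟨M, hM⟩ := (ht.eventually_gt_atTop (2 * Real.pi * C)).exists
  exact absurd (hbound M) (not_le.2 hM)

/-- Banach–Steinhaus is applied in `φ` for fixed `ψ`, then to the operator-valued maps in `ψ`. -/
theorem exists_pairingPartialSum_unbounded :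
    ∃ (ψ : Lp ℝ 1 (haarAddCircle (T := (1 : ℝ)))) (φ : C(AddCircle (1 : ℝ), ℝ)),
      ¬ ∃ C, ∀ K, ‖pairingPartialSum K ψ φ‖ ≤ C := by
  by_contra! h
  exact not_bounded_pairingPartialSum
    (banach_steinhaus fun ψ => banach_steinhaus fun φ => h ψ φ)

/-- A positive continuous function `φ` and a square integrable `η` on the circle for which the
formal Parseval series of `φ` and `|η|²` does not converge symmetrically. -/
theorem exists_parseval_not_tendsto :
    ∃ φ : C(AddCircle (1 : ℝ), ℝ), (∀ x, 1 ≤ φ x) ∧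
      ∃ η : AddCircle (1 : ℝ) → ℂ, MemLp η 2 haarAddCircle ∧
        ¬ ∃ l, Tendsto (fun K : ℕ => ∑ k ∈ Finset.Icc (-(K : ℤ)) (K : ℤ),
          fourierCoeff (fun x => (φ x : ℂ)) k * fourierCoeff (fun x => ((‖η x‖ ^ 2 : ℝ) : ℂ)) (-k))
          atTop (𝓝 l) := by
  by_contra! hcon
  obtain ⟨ψ, φ, hψφ⟩ := exists_pairingPartialSum_unbounded
  -- With `η = √ψ`, the assumed convergence gives bounded partial sums. Bilinearity then removes `0
  -- ≤ ψ` by splitting into positive and negative parts, and `1 ≤ φ` by adding a large constant.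
  have key : ∀ (φ : C(AddCircle (1 : ℝ), ℝ)), (∀ x, 1 ≤ φ x) →
      ∀ ψ : Lp ℝ 1 (haarAddCircle (T := (1 : ℝ))), 0 ≤ ψ →
      ∃ C, ∀ K, ‖pairingPartialSum K ψ φ‖ ≤ C := by
    intro φ hφ ψ hψ
    have hψ' : 0 ≤ᵐ[haarAddCircle] ψ := (Lp.coeFn_nonneg ψ).2 hψ
    set η : AddCircle (1 : ℝ) → ℂ := fun x => (Real.sqrt (ψ x) : ℂ)
    have hηsq : (fun x => ‖η x‖ ^ 2) =ᵐ[haarAddCircle] ψ := by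
      filter_upwards [hψ'] with x hx
      rw [Complex.norm_real, Real.norm_of_nonneg (Real.sqrt_nonneg _), Real.sq_sqrt hx]
    have hηm : AEStronglyMeasurable η haarAddCircle :=
      (Complex.continuous_ofReal.comp Real.continuous_sqrt).comp_aestronglyMeasurable
        (Lp.aestronglyMeasurable ψ)
    have hη : MemLp η 2 haarAddCircle :=
      (memLp_two_iff_integrable_sq_norm hηm).2 ((L1.integrable_coeFn ψ).congr hηsq.symm)
    obtain ⟨l, hl⟩ := hcon φ hφ η hη
    obtain ⟨C, hC⟩ := hl.norm.bddAbove_range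
    refine ⟨C, fun K => ?_⟩
    rw [pairingPartialSum_apply]
    have heq : fourierCoeff (fun x => ((‖η x‖ ^ 2 : ℝ) : ℂ)) =
        fourierCoeff (fun x => (ψ x : ℂ)) := by
      refine fourierCoeff_congr_ae ?_
      filter_upwards [hηsq] with x hx
      rw [hx]
    have := hC ⟨K, rfl⟩
    simpa only [heq] using this
  have key₂ : ∀ (φ : C(AddCircle (1 : ℝ), ℝ)), (∀ x, 1 ≤ φ x) →
      ∃ C, ∀ K, ‖pairingPartialSum K ψ φ‖ ≤ C := by
    intro φ hφ
    obtain ⟨C₁, h₁⟩ := key φ hφ _ (posPart_nonneg ψ)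
    obtain ⟨C₂, h₂⟩ := key φ hφ _ (negPart_nonneg ψ)
    refine ⟨C₁ + C₂, fun K => ?_⟩
    rw [show pairingPartialSum K ψ φ =
      pairingPartialSum K ψ⁺ φ - pairingPartialSum K ψ⁻ φ by
        rw [← _root_.sub_apply, ← map_sub, posPart_sub_negPart]]
    exact (norm_sub_le _ _).trans (add_le_add (h₁ K) (h₂ K))
  set c : C(AddCircle (1 : ℝ), ℝ) := ContinuousMap.const _ (‖φ‖ + 1) with hc
  obtain ⟨C₁, h₁⟩ := key₂ (φ + c) fun x => by
    have := (abs_le.1 (φ.norm_coe_le_norm x)).1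
    simp only [hc, ContinuousMap.add_apply, ContinuousMap.const_apply]
    linarith
  obtain ⟨C₂, h₂⟩ := key₂ c fun x => by simp [hc]
  refine hψφ ⟨C₁ + C₂, fun K => ?_⟩
  rw [show pairingPartialSum K ψ φ = pairingPartialSum K ψ (φ + c) - pairingPartialSum K ψ c by
    rw [map_add, add_sub_cancel_right]]
  exact (norm_sub_le _ _).trans (add_le_add (h₁ K) (h₂ K))

end CircleDivergence

/-! ### Parseval and Riesz–Fischer on the circle -/

section CircleL2

open AddCircle

theorem memLp_fourier_mul {u : AddCircle (1 : ℝ) → ℂ} (hu : MemLp u 2 haarAddCircle) (k : ℤ) :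
    MemLp (fun x => fourier k x * u x) 2 haarAddCircle := by
  refine hu.of_le ((fourier k).continuous.aestronglyMeasurable.mul hu.1)
    (Eventually.of_forall fun x => ?_)
  rw [norm_mul, fourier_apply, Circle.norm_coe, one_mul]

theorem fourierCoeff_fourier_mul (u : AddCircle (1 : ℝ) → ℂ) (k m : ℤ) :
    fourierCoeff (fun x => fourier k x * u x) m = fourierCoeff u (m - k) := by
  refine integral_congr_ae (Eventually.of_forall fun x => ?_)
  simp only [smul_eq_mul]
  rw [← mul_assoc, ← fourier_add, show -m + k = -(m - k) by ring]

/-- **Parseval's identity** for the Fourier coefficients of a product. -/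
theorem hasSum_conj_fourierCoeff_mul {u v : AddCircle (1 : ℝ) → ℂ} (hu : MemLp u 2 haarAddCircle)
    (hv : MemLp v 2 haarAddCircle) (k : ℤ) :
    HasSum (fun m : ℤ => conj (fourierCoeff u (m - k)) * fourierCoeff v m)
      (fourierCoeff (fun x => conj (u x) * v x) k) := by
  have h := fourierBasis.hasSum_inner_mul_inner ((memLp_fourier_mul hu k).toLp _) (hv.toLp v)
  have e₁ : (fun m : ℤ => conj (fourierCoeff u (m - k)) * fourierCoeff v m) = fun m =>
      inner ℂ ((memLp_fourier_mul hu k).toLp _) (fourierBasis m) *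
        inner ℂ (fourierBasis m) (hv.toLp v) := by
    ext m
    rw [← inner_conj_symm, ← HilbertBasis.repr_apply_apply, ← HilbertBasis.repr_apply_apply,
      fourierBasis_repr, fourierBasis_repr, fourierCoeff_congr_ae hv.coeFn_toLp,
      fourierCoeff_congr_ae (memLp_fourier_mul hu k).coeFn_toLp, fourierCoeff_fourier_mul]
  have e₂ : fourierCoeff (fun x => conj (u x) * v x) k =
      inner ℂ ((memLp_fourier_mul hu k).toLp _) (hv.toLp v) := by
    rw [L2.inner_def]
    refine integral_congr_ae ?_
    filter_upwards [hv.coeFn_toLp, (memLp_fourier_mul hu k).coeFn_toLp] with x h1 h2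
    rw [h1, h2, RCLike.inner_apply, fourier_neg, smul_eq_mul, map_mul]
    ring
  rw [e₁, e₂]
  exact h

theorem hasSum_norm_sq_fourierCoeff {v : AddCircle (1 : ℝ) → ℂ} (hv : MemLp v 2 haarAddCircle) :
    HasSum (fun m : ℤ => ‖fourierCoeff v m‖ ^ 2) (∫ x, ‖v x‖ ^ 2 ∂haarAddCircle) := by
  have h := hasSum_sq_fourierCoeff (hv.toLp v)
  rw [fourierCoeff_congr_ae hv.coeFn_toLp] at h
  convert h using 1
  refine integral_congr_ae ?_
  filter_upwards [hv.coeFn_toLp] with x hx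
  rw [hx]

theorem exists_memLp_fourierCoeff_eq {a : ℤ → ℂ} (ha : Summable fun n => ‖a n‖ ^ 2) :
    ∃ v : AddCircle (1 : ℝ) → ℂ, MemLp v 2 haarAddCircle ∧ fourierCoeff v = a := by
  have ha' : Memℓp a 2 := memℓp_gen (by simpa using ha)
  refine ⟨fourierBasis.repr.symm (⟨a, ha'⟩ : lp (fun _ : ℤ => ℂ) 2), Lp.memLp _, ?_⟩
  ext n
  rw [← fourierBasis_repr, LinearIsometryEquiv.apply_symm_apply]

theorem fourierCoeff_conj (v : AddCircle (1 : ℝ) → ℂ) (k : ℤ) :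
    fourierCoeff (fun x => conj (v x)) k = conj (fourierCoeff v (-k)) := by
  rw [fourierCoeff, fourierCoeff, ← integral_conj]
  simp only [smul_eq_mul, map_mul, ← fourier_neg, neg_neg]

end CircleL2

/-! ### Step functions on unit intervals -/

section StepFunctions

/-- Each fibre `[n, n+1)` has length one, so integrals of step functions become sums over `ℤ`. -/
theorem measurePreserving_floor :
    MeasurePreserving (Int.floor : ℝ → ℤ) volume Measure.count := by
  refine ⟨Int.measurable_floor, Measure.ext_of_singleton fun n => ?_⟩
  rw [Measure.map_apply Int.measurable_floor (measurableSet_singleton n),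
    Int.preimage_floor_singleton, Real.volume_Ico, Measure.count_singleton]
  simp

theorem integrable_comp_floor {c : ℤ → ℂ} (hc : Summable fun n => ‖c n‖) :
    Integrable (fun x : ℝ => c ⌊x⌋) :=
  measurePreserving_floor.integrable_comp_of_integrable (integrable_count_iff.2 hc)

theorem memLp_comp_floor {c : ℤ → ℂ} (hc : Summable fun n => ‖c n‖ ^ 2) :
    MemLp (fun x : ℝ => c ⌊x⌋) 2 := by
  refine MemLp.comp_measurePreserving (g := c) ?_ measurePreserving_floor
  refine (memLp_two_iff_integrable_sq_norm
    (measurable_of_countable c).aestronglyMeasurable).2 (integrable_count_iff.2 ?_)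
  simpa using hc

theorem floor_ae_eq_on_Ioc (n : ℤ) :
    ∀ᵐ x ∂(volume.restrict (Set.Ioc (n : ℝ) (n + 1))), ⌊x⌋ = n := by
  rw [← restrict_Ico_eq_restrict_Ioc]
  filter_upwards [ae_restrict_mem measurableSet_Ico] with x hx
  exact Int.floor_eq_iff.2 hx

theorem integral_comp_floor {c : ℤ → ℂ} (hc : Summable fun n => ‖c n‖) :
    ∫ x : ℝ, c ⌊x⌋ = ∑' n, c n := by
  have h := (integrable_comp_floor hc).hasSum_intervalIntegral 0
  rw [← h.tsum_eq]
  refine tsum_congr fun n => ?_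
  rw [zero_add, intervalIntegral.integral_of_le (by linarith),
    integral_congr_ae ((floor_ae_eq_on_Ioc n).mono fun x hx => by
      show c ⌊x⌋ = c n
      rw [hx])]
  simp

end StepFunctions

/-! ### Frame bounds for step windows -/

section Frame

open AddCircle

/-- The element `∑ₙ c(n) 1_[n,n+1)` of `L²(ℝ)`. -/
noncomputable def stepL2 {c : ℤ → ℂ} (hc : Summable fun n => ‖c n‖ ^ 2) : L2R :=
  (memLp_comp_floor hc).toLp

theorem stepL2_coeFn {c : ℤ → ℂ} (hc : Summable fun n => ‖c n‖ ^ 2) :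
    ∀ᵐ x : ℝ, stepL2 hc x = c ⌊x⌋ :=
  (memLp_comp_floor hc).coeFn_toLp

theorem stepL2_sub_coeFn {c : ℤ → ℂ} (hc : Summable fun n => ‖c n‖ ^ 2) :
    ∀ᵐ x : ℝ, ∀ n : ℤ, stepL2 hc (x - n) = c (⌊x⌋ - n) := by
  refine ae_all_iff.2 fun n => ?_
  filter_upwards [(measurePreserving_sub_right volume (n : ℝ)).quasiMeasurePreserving.ae
    (stepL2_coeFn hc)] with x hx
  rw [hx, Int.floor_sub_intCast]

/-- The Fourier coefficients of `f` on the interval `[l, l + 1]`. -/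
noncomputable def localFourierCoeff (f : ℝ → ℂ) (l m : ℤ) : ℂ :=
  fourierCoeffOn (lt_add_one (l : ℝ)) f m

theorem localFourierCoeff_eq (f : ℝ → ℂ) (l m : ℤ) :
    localFourierCoeff f l m =
      ∫ x in (l : ℝ)..(l + 1), conj (Complex.exp (2 * Real.pi * Complex.I * m * x)) * f x := by
  rw [localFourierCoeff, fourierCoeffOn_eq_integral, add_sub_cancel_left, div_one, one_smul]
  refine intervalIntegral.integral_congr fun x _ => ?_
  simp only [fourier_coe_apply, smul_eq_mul, ← Complex.exp_conj]
  congr 2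
  simp [map_ofNat (starRingEnd ℂ) 2]

theorem integral_norm_sq_eq (f : L2R) : ∫ x, ‖f x‖ ^ 2 = ‖f‖ ^ 2 := by
  have h : inner ℂ f f = ((‖f‖ ^ 2 : ℝ) : ℂ) := by
    rw [inner_self_eq_norm_sq_to_K]
    simp
  rw [L2.inner_def] at h
  have h' : ∀ x, inner ℂ (f x) (f x) = ((‖f x‖ ^ 2 : ℝ) : ℂ) := fun x => by
    rw [inner_self_eq_norm_sq_to_K]
    simp
  simp only [h'] at h
  rw [integral_complex_ofReal] at h
  exact_mod_cast h

/-- Parseval on each `[l, l+1]`, summed over `l`. The frequency is put first so that fibres over a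
fixed `m` can be summed later. -/
theorem hasSum_norm_sq_localFourierCoeff (f : L2R) :
    HasSum (fun p : ℤ × ℤ => ‖localFourierCoeff f p.2 p.1‖ ^ 2) (‖f‖ ^ 2) := by
  have hloc : ∀ l : ℤ, HasSum (fun m => ‖localFourierCoeff f l m‖ ^ 2)
      (∫ x in (l : ℝ)..(l + 1), ‖f x‖ ^ 2) := fun l => by
    have h := hasSum_sq_fourierCoeffOn (lt_add_one (l : ℝ))
      ((Lp.memLp f).restrict (Set.Ioc (l : ℝ) (l + 1)))
    simpa only [localFourierCoeff, add_sub_cancel_left, inv_one, one_smul] using h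
  have hint : Integrable fun x => ‖f x‖ ^ 2 :=
    (memLp_two_iff_integrable_sq_norm (Lp.aestronglyMeasurable f)).1 (Lp.memLp f)
  have hglob : HasSum (fun l : ℤ => ∫ x in (l : ℝ)..(l + 1), ‖f x‖ ^ 2) (‖f‖ ^ 2) := by
    have h := hint.hasSum_intervalIntegral 0
    simpa only [zero_add, integral_norm_sq_eq] using h
  have hs : Summable fun p : ℤ × ℤ => ‖localFourierCoeff f p.1 p.2‖ ^ 2 := by
    refine (summable_prod_of_nonneg fun _ => sq_nonneg _).2 ⟨fun l => (hloc l).summable, ?_⟩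
    simpa only [(hloc _).tsum_eq] using hglob.summable
  have h : HasSum (fun p : ℤ × ℤ => ‖localFourierCoeff f p.1 p.2‖ ^ 2) (‖f‖ ^ 2) := by
    rw [hs.hasSum_iff, hs.tsum_prod' fun l => (hloc l).summable]
    simpa only [(hloc _).tsum_eq] using hglob.tsum_eq
  exact (Equiv.prodComm ℤ ℤ).hasSum_iff.2 h

theorem hasSum_inner_whSystem {c : ℤ → ℂ} (hc : Summable fun n => ‖c n‖ ^ 2) (f : L2R)
    (m n : ℤ) :
    HasSum (fun l : ℤ => conj (c (l - n)) * localFourierCoeff f l m)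
      (inner ℂ (whSystem (stepL2 hc) 1 1 (m, n)) f) := by
  have h := (L2.integrable_inner (𝕜 := ℂ) (whSystem (stepL2 hc) 1 1 (m, n))
    f).hasSum_intervalIntegral 0
  rw [L2.inner_def]
  convert! h using 2 with l
  rw [zero_add, localFourierCoeff_eq, ← intervalIntegral.integral_const_mul,
    intervalIntegral.integral_of_le (by linarith), intervalIntegral.integral_of_le (by linarith)]
  refine integral_congr_ae ?_
  have hW : ∀ᵐ x : ℝ, whSystem (stepL2 hc) 1 1 (m, n) x =
      whModulate (m * 1) (whTranslate (n * 1) (stepL2 hc)) x := MemLp.coeFn_toLp _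
  filter_upwards [floor_ae_eq_on_Ioc l, ae_restrict_of_ae hW,
    ae_restrict_of_ae (stepL2_sub_coeFn hc)] with x hx h1 h2
  rw [h1, RCLike.inner_apply]
  simp only [whModulate, whTranslate, mul_one, map_mul, h2, hx, Complex.ofReal_intCast]
  ring

/-- For fixed `m`, let `v m` have the local coefficients of `f` at frequency `m` as its Fourier
coefficients. The inner products over `n` are the coefficients of `conj h * v m`, so Parseval
reduces the frame bounds to pointwise bounds on `|h|²`. -/
theorem isWHFrame_stepL2 {h : AddCircle (1 : ℝ) → ℂ} (hh : MemLp h 2 haarAddCircle) {A B : ℝ}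
    (hA : 0 < A) (hhA : ∀ x, A ≤ ‖h x‖ ^ 2) (hhB : ∀ x, ‖h x‖ ^ 2 ≤ B)
    (hc : Summable fun n => ‖fourierCoeff h n‖ ^ 2) : IsWHFrame (stepL2 hc) 1 1 := by
  have hB : 0 < B := hA.trans_le ((hhA 0).trans (hhB 0))
  refine ⟨A, B, hA, hB, fun f => ?_⟩
  have hf := hasSum_norm_sq_localFourierCoeff f
  have hfm : ∀ m : ℤ, Summable fun l => ‖localFourierCoeff f l m‖ ^ 2 :=
    fun m => hf.summable.prod_factor m
  choose v hv hva using fun m => exists_memLp_fourierCoeff_eq (hfm m)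
  have hS : ∀ m, HasSum (fun l => ‖localFourierCoeff f l m‖ ^ 2)
      (∫ x, ‖v m x‖ ^ 2 ∂haarAddCircle) := fun m => by
    simpa only [hva] using hasSum_norm_sq_fourierCoeff (hv m)
  have hSsum : HasSum (fun m => ∫ x, ‖v m x‖ ^ 2 ∂haarAddCircle) (‖f‖ ^ 2) :=
    hf.prod_fiberwise hS
  have hprod : ∀ m, MemLp (fun x => conj (h x) * v m x) 2 haarAddCircle := fun m => by
    refine (hv m).of_le_mul (c := Real.sqrt B)
      ((Complex.continuous_conj.comp_aestronglyMeasurable hh.1).mul (hv m).1)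
      (Eventually.of_forall fun x => ?_)
    rw [norm_mul, RCLike.norm_conj]
    gcongr
    exact Real.le_sqrt_of_sq_le (hhB x)
  have hinner : ∀ m n, inner ℂ (whSystem (stepL2 hc) 1 1 (m, n)) f =
      fourierCoeff (fun x => conj (h x) * v m x) n := fun m n => by
    refine (hasSum_inner_whSystem hc f m n).unique ?_
    simpa only [hva] using hasSum_conj_fourierCoeff_mul hh (hv m) n
  have hV : ∀ m, HasSum (fun n => ‖inner ℂ (whSystem (stepL2 hc) 1 1 (m, n)) f‖ ^ 2)
      (∫ x, ‖conj (h x) * v m x‖ ^ 2 ∂haarAddCircle) := fun m => by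
    simpa only [hinner] using hasSum_norm_sq_fourierCoeff (hprod m)
  have hint : ∀ m, Integrable (fun x => ‖v m x‖ ^ 2) haarAddCircle :=
    fun m => (memLp_two_iff_integrable_sq_norm (hv m).1).1 (hv m)
  have hint' : ∀ m, Integrable (fun x => ‖conj (h x) * v m x‖ ^ 2) haarAddCircle :=
    fun m => (memLp_two_iff_integrable_sq_norm (hprod m).1).1 (hprod m)
  have hlow : ∀ m, A * ∫ x, ‖v m x‖ ^ 2 ∂haarAddCircle ≤
      ∫ x, ‖conj (h x) * v m x‖ ^ 2 ∂haarAddCircle := fun m => by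
    rw [← integral_const_mul]
    refine integral_mono ((hint m).const_mul A) (hint' m) fun x => ?_
    simp only [norm_mul, RCLike.norm_conj, mul_pow]
    exact mul_le_mul_of_nonneg_right (hhA x) (sq_nonneg _)
  have hup : ∀ m, ∫ x, ‖conj (h x) * v m x‖ ^ 2 ∂haarAddCircle ≤
      B * ∫ x, ‖v m x‖ ^ 2 ∂haarAddCircle := fun m => by
    rw [← integral_const_mul]
    refine integral_mono (hint' m) ((hint m).const_mul B) fun x => ?_
    simp only [norm_mul, RCLike.norm_conj, mul_pow]
    exact mul_le_mul_of_nonneg_right (hhB x) (sq_nonneg _)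
  have hVsum : Summable fun m => ∫ x, ‖conj (h x) * v m x‖ ^ 2 ∂haarAddCircle :=
    Summable.of_nonneg_of_le (fun m => integral_nonneg fun x => sq_nonneg _) hup
      (hSsum.summable.mul_left B)
  have hsum : Summable fun p => ‖inner ℂ (whSystem (stepL2 hc) 1 1 p) f‖ ^ 2 := by
    refine (summable_prod_of_nonneg fun _ => sq_nonneg _).2 ⟨fun m => (hV m).summable, ?_⟩
    simpa only [(hV _).tsum_eq] using hVsum
  have htsum : ∑' p, ‖inner ℂ (whSystem (stepL2 hc) 1 1 p) f‖ ^ 2 =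
      ∑' m, ∫ x, ‖conj (h x) * v m x‖ ^ 2 ∂haarAddCircle := by
    rw [hsum.tsum_prod' fun m => (hV m).summable]
    exact tsum_congr fun m => (hV m).tsum_eq
  refine ⟨hsum, ?_, ?_⟩
  · rw [htsum, ← hSsum.tsum_eq, ← tsum_mul_left]
    exact (hSsum.summable.mul_left A).tsum_le_tsum hlow hVsum
  · rw [htsum, ← hSsum.tsum_eq, ← tsum_mul_left]
    exact hVsum.tsum_le_tsum hup (hSsum.summable.mul_left B)

end Frame

/-! ### The right side of the identity as a Parseval series -/

section Identity

open AddCircle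

theorem ae_hasSum_whCorrTerm_stepL2 {h : AddCircle (1 : ℝ) → ℂ} (hh : MemLp h 2 haarAddCircle)
    (hc : Summable fun n => ‖fourierCoeff h n‖ ^ 2) :
    ∀ᵐ t : ℝ, ∀ k : ℤ, HasSum (whCorrTerm (stepL2 hc) 1 1 k t)
      (fourierCoeff (fun x => ((‖h x‖ ^ 2 : ℝ) : ℂ)) k) := by
  filter_upwards [stepL2_sub_coeFn hc] with t ht k
  -- Reindexing by `n ↦ ⌊t⌋ - n` removes the dependence on `t`.
  have hsum := (Equiv.subLeft ⌊t⌋).hasSum_iff.2 (hasSum_conj_fourierCoeff_mul hh hh k)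
  have e : (fun x => conj (h x) * h x) = fun x => ((‖h x‖ ^ 2 : ℝ) : ℂ) := by
    ext x
    rw [Complex.conj_mul', Complex.ofReal_pow]
  rw [e] at hsum
  convert! hsum using 1
  ext n
  have h1 := ht n
  have h2 := ht (n + k)
  rw [Int.cast_add, ← sub_sub, ← sub_sub] at h2
  simp only [whCorrTerm, mul_one, div_one, h1, h2, Function.comp_apply, Equiv.subLeft_apply]
  ring

theorem conj_fourierCoeff_ofReal (v : AddCircle (1 : ℝ) → ℝ) (k : ℤ) :
    conj (fourierCoeff (fun x => (v x : ℂ)) k) = fourierCoeff (fun x => (v x : ℂ)) (-k) := by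
  have h := fourierCoeff_conj (fun x => (v x : ℂ)) (-k)
  simp only [Complex.conj_ofReal, neg_neg] at h
  exact h.symm

/-- Conjugated Parseval; since `|η|²` is real, conjugation turns index `k` into `-k`. -/
theorem hasSum_conj_mul_fourierCoeff_sub {η : AddCircle (1 : ℝ) → ℂ}
    (hη : MemLp η 2 haarAddCircle) (k : ℤ) :
    HasSum (fun n : ℤ => conj (fourierCoeff η n) * fourierCoeff η (n - k))
      (fourierCoeff (fun x => ((‖η x‖ ^ 2 : ℝ) : ℂ)) (-k)) := by
  have h := (hasSum_conj_fourierCoeff_mul hη hη k).mapL (Complex.conjCLE : ℂ →L[ℝ] ℂ)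
  have e : (fun x => conj (η x) * η x) = fun x => ((‖η x‖ ^ 2 : ℝ) : ℂ) := by
    ext x
    rw [Complex.conj_mul', Complex.ofReal_pow]
  rw [e] at h
  rw [← conj_fourierCoeff_ofReal]
  convert! h using 1
  ext n
  simp [mul_comm]

theorem whIntegrand_stepL2_ae_eq {h η : AddCircle (1 : ℝ) → ℂ} (hh : MemLp h 2 haarAddCircle)
    (hc : Summable fun n => ‖fourierCoeff h n‖ ^ 2)
    (hd : Summable fun n => ‖fourierCoeff η n‖ ^ 2) (k : ℤ) :
    whIntegrand (stepL2 hc) 1 1 (stepL2 hd) k =ᵐ[volume] fun t =>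
      (fun n : ℤ => conj (fourierCoeff η n) * fourierCoeff η (n - k) *
        fourierCoeff (fun x => ((‖h x‖ ^ 2 : ℝ) : ℂ)) k) ⌊t⌋ := by
  filter_upwards [ae_hasSum_whCorrTerm_stepL2 hh hc, stepL2_coeFn hd, stepL2_sub_coeFn hd]
    with t h1 h2 h3
  simp only [whIntegrand, whCorr, (h1 k).tsum_eq, h2, div_one, h3]

theorem integrable_whIntegrand_stepL2 {h η : AddCircle (1 : ℝ) → ℂ} (hh : MemLp h 2 haarAddCircle)
    (hη : MemLp η 2 haarAddCircle) (hc : Summable fun n => ‖fourierCoeff h n‖ ^ 2)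
    (hd : Summable fun n => ‖fourierCoeff η n‖ ^ 2) (k : ℤ) :
    Integrable (whIntegrand (stepL2 hc) 1 1 (stepL2 hd) k) :=
  (integrable_comp_floor ((hasSum_conj_mul_fourierCoeff_sub hη k).mul_right
    _).summable.norm).congr (whIntegrand_stepL2_ae_eq hh hc hd k).symm

theorem integral_whIntegrand_stepL2 {h η : AddCircle (1 : ℝ) → ℂ} (hh : MemLp h 2 haarAddCircle)
    (hη : MemLp η 2 haarAddCircle) (hc : Summable fun n => ‖fourierCoeff h n‖ ^ 2)
    (hd : Summable fun n => ‖fourierCoeff η n‖ ^ 2) (k : ℤ) :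
    ∫ t, whIntegrand (stepL2 hc) 1 1 (stepL2 hd) k t =
      fourierCoeff (fun x => ((‖h x‖ ^ 2 : ℝ) : ℂ)) k *
        fourierCoeff (fun x => ((‖η x‖ ^ 2 : ℝ) : ℂ)) (-k) := by
  have hs := (hasSum_conj_mul_fourierCoeff_sub hη k).mul_right
    (fourierCoeff (fun x => ((‖h x‖ ^ 2 : ℝ) : ℂ)) k)
  rw [integral_congr_ae (whIntegrand_stepL2_ae_eq hh hc hd k),
    integral_comp_floor hs.summable.norm, hs.tsum_eq, mul_comm]

end Identity

theorem mainTheorem7 :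
    ∃ g : L2R, IsWHFrame g 1 1 ∧
      (∀ᵐ t : ℝ, ∀ k : ℤ, Summable (whCorrTerm g 1 1 k t)) ∧
      ∃ f : L2R,
        (∀ k : ℤ, Integrable (whIntegrand g 1 1 f k) volume) ∧
        ¬ WHConvergesSymmetrically g 1 1 f := by
  obtain ⟨φ, hφ, η, hη, hdiv⟩ := exists_parseval_not_tendsto
  -- Then `|h|² = φ` lies between `1` and `‖φ‖`, which are the frame bounds.
  set h : AddCircle (1 : ℝ) → ℂ := fun x => (Real.sqrt (φ x) : ℂ)
  have hsq : ∀ x, ‖h x‖ ^ 2 = φ x := fun x => by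
    rw [Complex.norm_real, Real.norm_of_nonneg (Real.sqrt_nonneg _),
      Real.sq_sqrt (zero_le_one.trans (hφ x))]
  have hcont : Continuous h := by fun_prop
  have hh : MemLp h 2 AddCircle.haarAddCircle :=
    hcont.memLp_of_hasCompactSupport (HasCompactSupport.of_compactSpace _)
  have hc := (hasSum_norm_sq_fourierCoeff hh).summable
  have hd := (hasSum_norm_sq_fourierCoeff hη).summable
  refine ⟨stepL2 hc, isWHFrame_stepL2 hh one_pos (fun x => (hsq x).symm ▸ hφ x)
    (fun x => (hsq x).symm ▸ φ.apply_le_norm x) hc, ?_, stepL2 hd,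
    integrable_whIntegrand_stepL2 hh hη hc hd, ?_⟩
  · filter_upwards [ae_hasSum_whCorrTerm_stepL2 hh hc] with t ht k
    exact (ht k).summable
  · rintro ⟨l, hl⟩
    refine hdiv ⟨l, hl.congr fun K => ?_⟩
    simp only [whSymmPartialSum, Complex.ofReal_one, div_one, one_mul,
      integral_whIntegrand_stepL2 hh hη hc hd, hsq]
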